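/- Let $V=\{1,\dots,|V|\}$ with $|V|>1$, let $Z_V=(Z_i)_{i\in V}$ be discrete random variables with finite joint entropy, let $H(X)$ be the Shannon entropy of $(Z_i)_{i\in X}$ for $X\subseteq V$, and let $H(X\mid Y)=H(X\cup Y)-H(Y)$. For a real vector $r$ write $r(X)=\sum_{i\in X}r_i$. For $C\subseteq V$ with $|C|>1$, the achievable rate region for omniscience in $C$ is $\mathscr R(C)=\{r : r(X)\ge H(X\mid C\setminus X)\ \forall X\subsetneq C\}$, $R_{CO}(C)=\min\{r(C): r\in\mathscr R(C)\}$, and $r$ is an optimal rate vector for $C$ if it attains this minimum. A set $C\subsetneq V$ with $|C|>1$ is complimentary (for successive omniscience) if local omniscience in $C$ at rate $R_{CO}(C)$ can be attained first without increasing the overall minimum sum-rate: there are an optimal rate vector $r^{(1)}$ for $C$ (zero outside $C$) and a nonnegative vector $r^{(2)}$ such that $r^{(1)}+r^{(2)}$ is an optimal rate vector for $V$. For $\alpha\ge 0$ let $f_\alpha(X)=\alpha-H(V)+H(X)$ for $\emptyset\ne X\subseteq V$, $f_\alpha(\emptyset)=0$, and let $\hat f_\alpha(C)=\min_{\mathcal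 P}\sum_{B\in\mathcal P}f_\alpha(B)$ over all partitions $\mathcal P$ of $C$. Put $V_i=\{1,\dots,i\}$. The parametric (PAR) algorithm computes, for all $\alpha$, a partition $\mathcal Q_\alpha(V_i)$ of $V_i$ and a rate vector $r_\alpha$ as follows. Initially $r_{\alpha,j}=\alpha-H(V)$ for $j\ne 1$, $r_{\alpha,1}=f_\alpha(\{1\})$ and $\mathcal Q_\alpha(V_1)=\{\{1\}\}$. In iteration $i=2,\dots,|V|$, set $\mathcal Q=\mathcal Q_\alpha(V_{i-1})\cup\{\{i\}\}$; let $\mathcal U$ be the intersection of all minimizers of $f_\alpha(\tilde{\mathcal X})-r_\alpha(\tilde{\mathcal X})$ over $\{i\}\in\mathcal X\subseteq\mathcal Q$, where $\tilde{\mathcal X}=\bigcup_{B\in\mathcal X}B$; then increase $r_{\alpha,i}$ by $f_\alpha(\tilde{\mathcal U})-r_\alpha(\tilde{\mathcal U})$ and set $\mathcal Q_\alpha(V_i)=(\mathcal Q\setminus\mathcal U)\cup\{\tilde{\mathcal U}\}$. Let $r_{\alpha,V_i}$ be the restriction to $V_i$ of the rate vector at the end of iteration $i$. **Theorem.** Let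 $i\in\{2,\dots,|V|\}$ and $\bar\alpha=\sum_{j\in V}\frac{H(V)-H(\{j\})}{|V|-1}$. Then every $C\in\mathcal Q_{\bar\alpha}(V_i)$ with $|C|>1$ satisfies $f_{\bar\alpha}(C)=\hat f_{\bar\alpha}(C)$ and is a complimentary subset. Moreover, the minimum $\alpha_C$ of all $\alpha\ge0$ with $f_\alpha(C)=\hat f_\alpha(C)$ exists, and the restriction $r_{\alpha_C,C}$ of $r_{\alpha_C,V_i}$ to $C$ is an optimal rate vector for local omniscience in $C$, with $r_{\alpha_C}(C)=R_{CO}(C)$. -/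

import Mathlib

open MeasureTheory

noncomputable section

namespace Omniscience

/-- The Shannon entropy, in bits, of the subfamily `(Z i : i ∈ X)` of a family of discrete random
variables: `H(X) = - ∑ p(s) log₂ p(s)`, where `s` runs over the joint alphabet of the subfamily. -/
def jointEntropy {n : ℕ} {Ω : Type*} [MeasurableSpace Ω] (μ : Measure Ω)
    {S : Fin n → Type*} (Z : ∀ i, Ω → S i) (X : Finset (Fin n)) : ℝ :=
  (∑' s : (∀ i : X, S i), Real.negMulLog (μ.real {ω | ∀ i : X, Z i ω = s i})) / Real.log 2

section Rates

variable {n : ℕ} (H : Finset (Fin n) → ℝ)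

/-- The conditional entropy `H(X | Y) = H(X ∪ Y) - H(Y)`. -/
def condEntropy (X Y : Finset (Fin n)) : ℝ := H (X ∪ Y) - H Y

/-- The region of rate vectors achieving omniscience among the users in `C`: the multiterminal
Slepian-Wolf constraints `r(X) ≥ H(X | C \ X)` for all `X ⊊ C`. Only the coordinates in `C` of a
rate vector matter. -/
def achievableRegion (C : Finset (Fin n)) : Set (Fin n → ℝ) :=
  {r | ∀ X : Finset (Fin n), X ⊂ C → condEntropy H X (C \ X) ≤ ∑ i ∈ X, r i}

/-- The minimum sum-rate for omniscience in `C`. -/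
def minSumRate (C : Finset (Fin n)) : ℝ :=
  sInf ((fun r : Fin n → ℝ => ∑ i ∈ C, r i) '' achievableRegion H C)

/-- The coordinates in `C` of `r` form an optimal rate vector for omniscience in `C`: it is
achievable and no achievable rate vector has a smaller sum-rate. -/
def IsOptimalRate (C : Finset (Fin n)) (r : Fin n → ℝ) : Prop :=
  r ∈ achievableRegion H C ∧
    IsLeast ((fun r' : Fin n → ℝ => ∑ i ∈ C, r' i) '' achievableRegion H C) (∑ i ∈ C, r i)

/-- `C` is a complimentary subset for successive omniscience: a non-singleton proper subset of the
users in which local omniscience can be attained first, by an optimal rate vector `r₁` for `C`,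
after which additional transmissions at nonnegative rates `r₂` attain global omniscience, the
overall rate vector `r₁ + r₂` being optimal for the whole user set. -/
def IsComplimentary (C : Finset (Fin n)) : Prop :=
  1 < C.card ∧ C ⊂ Finset.univ ∧
    ∃ r₁ r₂ : Fin n → ℝ, (∀ i, i ∉ C → r₁ i = 0) ∧ (∀ i, 0 ≤ r₂ i) ∧
      IsOptimalRate H C r₁ ∧ IsOptimalRate H Finset.univ (r₁ + r₂)

/-- The set function `f_α(X) = α - H(V) + H(X)` for `X ≠ ∅`, and `f_α(∅) = 0`. -/
def fα (α : ℝ) (X : Finset (Fin n)) : ℝ :=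
  if X = ∅ then 0 else α - H Finset.univ + H X

/-- The Dilworth truncation `f̂_α(C)`: the minimum over all partitions `P` of `C` of
`∑ B ∈ P, f_α(B)`. -/
def dilworth (α : ℝ) (C : Finset (Fin n)) : ℝ :=
  (Finset.univ : Finset (Finpartition C)).inf' ⟨⊥, Finset.mem_univ _⟩
    fun P => ∑ B ∈ P.parts, fα H α B

end Rates

/-! ### The parametric algorithm -/

/-- The state of the algorithm at one value of `α`: a rate vector on all users, and the blocks of
the current partition of the users processed so far. -/
structure ParState (n : ℕ) where
  /-- the rate vector -/
  rate : Fin n → ℝ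
  /-- the blocks of the partition -/
  blocks : Finset (Finset (Fin n))

/-- The fusion (union of the members) of a family of sets. -/
def fusion {n : ℕ} (𝒳 : Finset (Finset (Fin n))) : Finset (Fin n) := 𝒳.biUnion id

/-- The function `f_α(X̃) - r(X̃)` of a family `𝒳` with fusion `X̃`. -/
def fusedFun {n : ℕ} (H : Finset (Fin n) → ℝ) (α : ℝ) (r : Fin n → ℝ)
    (𝒳 : Finset (Finset (Fin n))) : ℝ :=
  fα H α (fusion 𝒳) - ∑ j ∈ fusion 𝒳, r j

/-- The families `𝒳` with `{i} ∈ 𝒳 ⊆ 𝒬`. -/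
def candidates {n : ℕ} (𝒬 : Finset (Finset (Fin n))) (i : Fin n) :
    Finset (Finset (Finset (Fin n))) :=
  𝒬.powerset.filter fun 𝒳 => {i} ∈ 𝒳

/-- The families that attain `min {f_α(X̃) - r(X̃) : {i} ∈ 𝒳 ⊆ 𝒬}`. -/
def minimizers {n : ℕ} (H : Finset (Fin n) → ℝ) (α : ℝ) (r : Fin n → ℝ)
    (𝒬 : Finset (Finset (Fin n))) (i : Fin n) : Finset (Finset (Finset (Fin n))) :=
  (candidates 𝒬 i).filter fun 𝒳 =>
    ∀ 𝒴 ∈ candidates 𝒬 i, fusedFun H α r 𝒳 ≤ fusedFun H α r 𝒴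

/-- The minimal minimizer: the intersection of all minimizers. -/
def minimalMinimizer {n : ℕ} (H : Finset (Fin n) → ℝ) (α : ℝ) (r : Fin n → ℝ)
    (𝒬 : Finset (Finset (Fin n))) (i : Fin n) : Finset (Finset (Fin n)) :=
  𝒬.filter fun B => ∀ 𝒳 ∈ minimizers H α r 𝒬 i, B ∈ 𝒳

/-- One iteration, for the new user `i`: add the block `{i}`, find the minimal minimizer `𝒰`, raise
the rate of user `i` by `f_α(Ũ) - r(Ũ)`, and merge the blocks in `𝒰` into one block `Ũ`. -/
def parStep {n : ℕ} (H : Finset (Fin n) → ℝ) (α : ℝ) (i : Fin n) (s : ParState n) :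
    ParState n :=
  let 𝒬 := s.blocks ∪ {{i}}
  let 𝒰 := minimalMinimizer H α s.rate 𝒬 i
  { rate := s.rate + Pi.single i (fusedFun H α s.rate 𝒰)
    blocks := (𝒬 \ 𝒰) ∪ {fusion 𝒰} }

/-- The state of the parametric algorithm at the end of iteration `k`, as a function of `α`. The
users are `0, …, n - 1`, so that iteration `k` processes the user with index `k - 1` and leaves a
partition of the first `k` users. The end of iteration `1` is the initialization: every rate is
`α - H(V)`, except that the first user has rate `f_α` of its singleton, and the partition has that
singleton as its only block. (Index `0` stands for the state before any user has been processed.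
Beyond iteration `n` nothing changes.) -/
def par {n : ℕ} (H : Finset (Fin n) → ℝ) : ℕ → ℝ → ParState n
  | 0, α => { rate := fun _ => α - H Finset.univ, blocks := ∅ }
  | 1, α =>
    { rate := fun j => if j.val = 0 then fα H α {j} else α - H Finset.univ
      blocks := {Finset.univ.filter fun j => j.val = 0} }
  | k + 2, α =>
    if h : k + 1 < n then parStep H α ⟨k + 1, h⟩ (par H (k + 1) α) else par H (k + 1) α

/-- The lower bound `ᾱ = ∑ i ∈ V, (H(V) - H({i})) / (|V| - 1)` on the minimum sum-rate. -/
def alphaBar {n : ℕ} (H : Finset (Fin n) → ℝ) : ℝ :=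
  ∑ i : Fin n, (H Finset.univ - H {i}) / ((n : ℝ) - 1)

end Omniscience

end

/-! Three properties of the entropy suffice: `H ∅ = 0`, monotonicity and submodularity. Call `r`
feasible at `α` if `r(X) ≤ f_α(X)` for all nonempty `X`, and call `X` tight if equality holds.
Passing from `X` to `C \ X` turns the Slepian-Wolf constraints into feasibility on `C` with `C`
tight, at `α = r(C) - H(C) + H(V)`. Such a vector certifies that `f_α(C)` equals its Dilworth
truncation, so at the least `α` with that equality any feasible vector with `C` tight is optimal
(`isOptimalRate_of_isLeast`).

Since `f_α` is submodular on intersecting pairs, the algorithm maintains a feasible vector and a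
partition into tight blocks (`IsTightPartition.parStep`). The partitions coarsen as `α` grows
(`IsTightPartition.subset_of_inter_nonempty`). A block `C` at `ᾱ` is therefore a union of blocks at
`α_C ≤ ᾱ`, which makes it tight there too (`IsTightPartition.tight_of_le`).

For complimentarity, let `b` be the critical value of `V`. Then `α_C ≤ ᾱ ≤ b`, and an optimal vector
for `C`, extended by zero, is feasible at `b`; it grows greedily to one with `V` tight
(`IsFeasible.exists_le_sum_eq`). Finally `C ≠ V`: at `ᾱ` the partition into singletons ties with
`{V}`, and minimality of the minimizer forbids the last merge. -/

noncomputable section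

namespace Omniscience

/-! ### The set function `f_α` and partitions -/

section Combinatorics

variable {n : ℕ} {H : Finset (Fin n) → ℝ} {α β : ℝ}

/-- Submodularity of a set function on the subsets of `Fin n`. -/
def IsSubmodular (H : Finset (Fin n) → ℝ) : Prop :=
  ∀ X Y, H (X ∪ Y) + H (X ∩ Y) ≤ H X + H Y

theorem fα_of_nonempty {X : Finset (Fin n)} (hX : X.Nonempty) :
    fα H α X = α - H Finset.univ + H X := by
  simp [fα, hX.ne_empty]

theorem continuous_fα (X : Finset (Fin n)) : Continuous fun α => fα H α X := by
  rcases X.eq_empty_or_nonempty with rfl | hX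
  · simpa [fα] using continuous_const
  · simp only [fα_of_nonempty hX]
    fun_prop

/-- The constant `α - H(V)` occurs twice on each side. For disjoint sets this fails, because `f_α(∅)
= 0` drops one copy. -/
theorem IsSubmodular.fα_union_add_inter (hs : IsSubmodular H) {X Y : Finset (Fin n)}
    (h : (X ∩ Y).Nonempty) :
    fα H α (X ∪ Y) + fα H α (X ∩ Y) ≤ fα H α X + fα H α Y := by
  have hX : X.Nonempty := h.mono Finset.inter_subset_left
  have hY : Y.Nonempty := h.mono Finset.inter_subset_right
  rw [fα_of_nonempty h, fα_of_nonempty hX, fα_of_nonempty hY,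
    fα_of_nonempty (hX.mono Finset.subset_union_left)]
  linarith [hs X Y]

theorem mem_fusion {𝒳 : Finset (Finset (Fin n))} {j : Fin n} :
    j ∈ fusion 𝒳 ↔ ∃ B ∈ 𝒳, j ∈ B := by
  simp [fusion]

theorem fusion_union (𝒳 𝒴 : Finset (Finset (Fin n))) :
    fusion (𝒳 ∪ 𝒴) = fusion 𝒳 ∪ fusion 𝒴 :=
  Finset.union_biUnion

theorem fusion_singleton (B : Finset (Fin n)) : fusion {B} = B := by
  simp [fusion]

theorem fusion_insert (B : Finset (Fin n)) (𝒳 : Finset (Finset (Fin n))) :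
    fusion (insert B 𝒳) = B ∪ fusion 𝒳 := by
  simp [fusion]

theorem subset_fusion {𝒳 : Finset (Finset (Fin n))} {B : Finset (Fin n)} (hB : B ∈ 𝒳) :
    B ⊆ fusion 𝒳 :=
  fun _ hj => mem_fusion.2 ⟨B, hB, hj⟩

theorem fusion_inter {𝒬 𝒳 𝒴 : Finset (Finset (Fin n))}
    (hd : (𝒬 : Set (Finset (Fin n))).PairwiseDisjoint id) (hX : 𝒳 ⊆ 𝒬) (hY : 𝒴 ⊆ 𝒬) :
    fusion (𝒳 ∩ 𝒴) = fusion 𝒳 ∩ fusion 𝒴 := by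
  ext j
  simp only [mem_fusion, Finset.mem_inter]
  constructor
  · rintro ⟨B, ⟨hBX, hBY⟩, hj⟩
    exact ⟨⟨B, hBX, hj⟩, ⟨B, hBY, hj⟩⟩
  · rintro ⟨⟨B, hB, hj⟩, ⟨D, hD, hj'⟩⟩
    obtain rfl : B = D := hd.elim_finset (hX hB) (hY hD) j hj hj'
    exact ⟨B, ⟨hB, hD⟩, hj⟩

theorem sum_fusion {𝒳 : Finset (Finset (Fin n))}
    (hd : (𝒳 : Set (Finset (Fin n))).PairwiseDisjoint id) (r : Fin n → ℝ) :
    ∑ j ∈ fusion 𝒳, r j = ∑ B ∈ 𝒳, ∑ j ∈ B, r j :=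
  Finset.sum_biUnion hd

/-- Uncrossing a set with a family of disjoint sets. -/
theorem IsSubmodular.union_fusion_add_sum_inter (hs : IsSubmodular H)
    (B : Finset (Fin n)) (𝒳 : Finset (Finset (Fin n)))
    (hd : (𝒳 : Set (Finset (Fin n))).PairwiseDisjoint id) :
    H (B ∪ fusion 𝒳) + ∑ D ∈ 𝒳, H (B ∩ D) ≤ H B + ∑ D ∈ 𝒳, H D := by
  induction 𝒳 using Finset.induction_on with
  | empty => simp [fusion]
  | insert D 𝒳 hD ih =>
    rw [Finset.coe_insert] at hd
    have ih := ih (hd.subset (Set.subset_insert _ _))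
    have hdisj : D ∩ fusion 𝒳 = ∅ := by
      rw [← Finset.disjoint_iff_inter_eq_empty, fusion, Finset.disjoint_biUnion_right]
      intro E hE
      exact hd (Set.mem_insert _ _) (Set.mem_insert_of_mem _ hE) (by rintro rfl; exact hD hE)
    have h := hs (B ∪ fusion 𝒳) D
    have e1 : (B ∪ fusion 𝒳) ∩ D = B ∩ D := by
      rw [Finset.union_inter_distrib_right, Finset.inter_comm (fusion 𝒳), hdisj,
        Finset.union_empty]
    have e2 : (B ∪ fusion 𝒳) ∪ D = B ∪ fusion (insert D 𝒳) := by
      rw [fusion_insert, Finset.union_assoc, Finset.union_comm D]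
    rw [e1, e2] at h
    rw [Finset.sum_insert hD, Finset.sum_insert hD]
    linarith

/-! ### The Dilworth truncation -/

theorem dilworth_le (C : Finset (Fin n)) (P : Finpartition C) :
    dilworth H α C ≤ ∑ B ∈ P.parts, fα H α B :=
  Finset.inf'_le _ (Finset.mem_univ P)

theorem dilworth_le_sum {𝒳 : Finset (Finset (Fin n))}
    (hd : (𝒳 : Set (Finset (Fin n))).PairwiseDisjoint id) (he : ∅ ∉ 𝒳) :
    dilworth H α (fusion 𝒳) ≤ ∑ B ∈ 𝒳, fα H α B := by
  let P : Finpartition (fusion 𝒳) :=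
    { parts := 𝒳
      supIndep := Finset.supIndep_iff_pairwiseDisjoint.2 hd
      sup_parts := by rw [fusion, Finset.sup_eq_biUnion]
      bot_notMem := he }
  exact dilworth_le _ P

theorem dilworth_le_fα (C : Finset (Fin n)) (hC : C.Nonempty) : dilworth H α C ≤ fα H α C := by
  simpa [fusion_singleton] using
    dilworth_le_sum (H := H) (α := α) (𝒳 := {C}) (by simp) (by simpa using hC.ne_empty.symm)

theorem fα_eq_dilworth_iff {C : Finset (Fin n)} (hC : C.Nonempty) :
    fα H α C = dilworth H α C ↔
      ∀ P : Finpartition C, fα H α C ≤ ∑ B ∈ P.parts, fα H α B := by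
  constructor
  · intro h P
    exact h.le.trans (dilworth_le C P)
  · intro h
    exact le_antisymm (Finset.le_inf' _ _ fun P _ => h P) (dilworth_le_fα C hC)

/-! ### Feasible vectors and tight sets -/

/-- `r(X) ≤ f_α(X)` for every nonempty `X ⊆ W`. -/
def IsFeasible (H : Finset (Fin n) → ℝ) (α : ℝ) (W : Finset (Fin n)) (r : Fin n → ℝ) : Prop :=
  ∀ X ⊆ W, X.Nonempty → ∑ j ∈ X, r j ≤ fα H α X

theorem IsFeasible.mono {W W' : Finset (Fin n)} {r : Fin n → ℝ} (h : IsFeasible H α W r)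
    (hW : W' ⊆ W) : IsFeasible H α W' r :=
  fun X hX => h X (hX.trans hW)

/-- Weak duality: `r(C)` splits along any partition, and each block contributes at most its `f_α`.
-/
theorem IsFeasible.fα_eq_dilworth {C : Finset (Fin n)} {r : Fin n → ℝ} (hC : C.Nonempty)
    (h : IsFeasible H α C r) (ht : ∑ j ∈ C, r j = fα H α C) : fα H α C = dilworth H α C := by
  rw [fα_eq_dilworth_iff hC]
  intro P
  rw [← ht]
  calc ∑ j ∈ C, r j = ∑ B ∈ P.parts, ∑ j ∈ B, r j := by
        rw [← sum_fusion P.disjoint, fusion, P.biUnion_parts]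
    _ ≤ _ := Finset.sum_le_sum fun B hB => h B (P.le hB) (P.nonempty_of_mem_parts hB)

/-- In the presence of a tight set, the excess `f_α - r` does not grow by taking the union with
an intersecting tight set. -/
theorem IsFeasible.excess_union_le (hs : IsSubmodular H) {X B : Finset (Fin n)} {r : Fin n → ℝ}
    (h : IsFeasible H α B r) (ht : ∑ j ∈ B, r j = fα H α B) (hX : (X ∩ B).Nonempty) :
    fα H α (X ∪ B) - ∑ j ∈ X ∪ B, r j ≤ fα H α X - ∑ j ∈ X, r j := by
  have h1 := hs.fα_union_add_inter (α := α) hX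
  have h2 := h _ Finset.inter_subset_right hX
  have h3 := Finset.sum_union_inter (s₁ := X) (s₂ := B) (f := r)
  linarith

/-! ### The critical value of `α` -/

/-- Finitely many closed conditions cut out the set. It contains `H(V)`, where `f_α` agrees with `H`
on nonempty sets and subadditivity applies. -/
theorem exists_isLeast (hs : IsSubmodular H) (h0 : H ∅ = 0) (hm : Monotone H)
    {C : Finset (Fin n)} (hC : C.Nonempty) :
    ∃ a, IsLeast {α : ℝ | 0 ≤ α ∧ fα H α C = dilworth H α C} a := by
  have hset : {α : ℝ | 0 ≤ α ∧ fα H α C = dilworth H α C} =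
      Set.Ici 0 ∩ ⋂ P : Finpartition C, {α | fα H α C ≤ ∑ B ∈ P.parts, fα H α B} := by
    ext a
    simp [fα_eq_dilworth_iff hC]
  have hclosed : IsClosed {α : ℝ | 0 ≤ α ∧ fα H α C = dilworth H α C} := by
    rw [hset]
    exact isClosed_Ici.inter <| isClosed_iInter fun P =>
      isClosed_le (continuous_fα C) (continuous_finsetSum _ fun B _ => continuous_fα B)
  have hmem : H Finset.univ ∈ {α : ℝ | 0 ≤ α ∧ fα H α C = dilworth H α C} := by
    refine ⟨h0 ▸ hm (Finset.empty_subset _), (fα_eq_dilworth_iff hC).2 fun P => ?_⟩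
    have h1 := hs.union_fusion_add_sum_inter ∅ P.parts P.disjoint
    rw [fusion, P.biUnion_parts] at h1
    simp only [Finset.empty_union, Finset.empty_inter, h0, Finset.sum_const_zero] at h1
    rw [Finset.sum_congr rfl fun B hB => fα_of_nonempty (P.nonempty_of_mem_parts hB),
      fα_of_nonempty hC]
    simp only [sub_self, zero_add]
    linarith
  exact ⟨_, hclosed.csInf_mem ⟨_, hmem⟩ ⟨0, fun _ h => h.1⟩,
    fun _ h => csInf_le ⟨0, fun _ h => h.1⟩ h⟩

/-- Complementation within `C` is a dictionary between achievable vectors of a given sum-rate and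
feasible vectors with `C` tight. A cheaper achievable vector would certify a smaller `α`. -/
theorem isOptimalRate_of_isLeast (hm : Monotone H) {C : Finset (Fin n)} (hcard : 1 < C.card)
    {a : ℝ} (ha : IsLeast {α : ℝ | 0 ≤ α ∧ fα H α C = dilworth H α C} a) {r : Fin n → ℝ}
    (hr : IsFeasible H a C r) (ht : ∑ j ∈ C, r j = fα H a C) : IsOptimalRate H C r := by
  have hC : C.Nonempty := Finset.card_pos.1 (by omega)
  have hsplit : ∀ (r : Fin n → ℝ) (X : Finset (Fin n)), X ⊆ C →
      ∑ j ∈ C \ X, r j + ∑ j ∈ X, r j = ∑ j ∈ C, r j := fun r X hX => Finset.sum_sdiff hX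
  have hach : r ∈ achievableRegion H C := by
    intro X hX
    have hne : (C \ X).Nonempty := Finset.sdiff_nonempty.2 hX.2
    have h1 := hr (C \ X) Finset.sdiff_subset hne
    have h2 := hsplit r X hX.1
    rw [condEntropy, Finset.union_sdiff_of_subset hX.1]
    rw [fα_of_nonempty hne] at h1
    rw [fα_of_nonempty hC] at ht
    linarith
  refine ⟨hach, ⟨r, hach, rfl⟩, ?_⟩
  rintro _ ⟨r', hr', rfl⟩
  dsimp only
  -- Needed only for `0 ≤ b` below.
  have hpos : 0 ≤ ∑ j ∈ C, r' j := by
    refine Finset.sum_nonneg fun j hj => ?_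
    have hss : {j} ⊂ C := by
      refine Finset.ssubset_iff_subset_ne.2 ⟨by simpa using hj, ?_⟩
      rintro rfl
      simp at hcard
    have h1 := hr' {j} hss
    rw [condEntropy, Finset.union_sdiff_of_subset hss.1, Finset.sum_singleton] at h1
    linarith [hm (Finset.sdiff_subset : C \ {j} ⊆ C)]
  -- The value of `α` at which `r'` makes `C` tight.
  set b : ℝ := ∑ j ∈ C, r' j - H C + H Finset.univ with hb
  have htb : ∑ j ∈ C, r' j = fα H b C := by
    rw [fα_of_nonempty hC]
    linarith
  have hfb : IsFeasible H b C r' := by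
    intro X hX hXne
    by_cases hXC : X = C
    · rw [hXC, htb]
    · have hss : C \ X ⊂ C := Finset.sdiff_ssubset hX hXne
      have h1 := hr' _ hss
      rw [condEntropy, Finset.sdiff_sdiff_eq_self hX, Finset.sdiff_union_of_subset hX] at h1
      rw [fα_of_nonempty hXne]
      linarith [hsplit r' X hX]
  have hle := ha.2 ⟨by linarith [hm (Finset.subset_univ C)], hfb.fα_eq_dilworth hC htb⟩
  rw [ht, fα_of_nonempty hC]
  linarith

theorem IsOptimalRate.sum_eq_minSumRate {C : Finset (Fin n)} {r : Fin n → ℝ}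
    (h : IsOptimalRate H C r) : ∑ j ∈ C, r j = minSumRate H C :=
  h.2.csInf_eq.symm

/-! ### Greedy extension of a feasible vector -/

/-- Each coordinate in turn is raised as far as feasibility permits, by the least excess of a set
containing it. -/
theorem IsFeasible.exists_le_tight {r₀ : Fin n → ℝ} (h : IsFeasible H α Finset.univ r₀)
    (S : Finset (Fin n)) :
    ∃ r, r₀ ≤ r ∧ IsFeasible H α Finset.univ r ∧
      ∀ j ∈ S, ∃ T : Finset (Fin n), j ∈ T ∧ ∑ k ∈ T, r k = fα H α T := by
  induction S using Finset.induction_on with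
  | empty => exact ⟨r₀, le_rfl, h, by simp⟩
  | insert i S hi ih =>
    obtain ⟨r, hle, hf, ht⟩ := ih
    obtain ⟨U, hU, hmin⟩ := Finset.exists_min_image
      (Finset.univ.filter fun X : Finset (Fin n) => i ∈ X)
      (fun X => fα H α X - ∑ k ∈ X, r k) ⟨{i}, by simp⟩
    simp only [Finset.mem_filter, Finset.mem_univ, true_and] at hU hmin
    set m := fα H α U - ∑ k ∈ U, r k with hm
    have hm0 : 0 ≤ m := sub_nonneg.2 (hf U (Finset.subset_univ _) ⟨i, hU⟩)
    have hsum : ∀ X : Finset (Fin n),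
        ∑ k ∈ X, (r + Pi.single i m : Fin n → ℝ) k = ∑ k ∈ X, r k + if i ∈ X then m else 0 := by
      intro X
      simp [Finset.sum_add_distrib, Finset.sum_pi_single']
    refine ⟨r + Pi.single i m, ?_, ?_, ?_⟩
    · exact hle.trans (le_add_of_nonneg_right (Pi.single_nonneg.2 hm0))
    · intro X hX hXne
      rw [hsum]
      split_ifs with hiX
      · linarith [hmin X hiX]
      · simpa using hf X hX hXne
    · intro j hj
      rcases Finset.mem_insert.1 hj with rfl | hj
      · exact ⟨U, hU, by rw [hsum, if_pos hU]; linarith⟩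
      · obtain ⟨T, hjT, hT⟩ := ht j hj
        refine ⟨T, hjT, ?_⟩
        rw [hsum]
        split_ifs with hiT
        -- A set already tight and containing `i` has zero excess, so it forces `m = 0`.
        · linarith [hmin T hiT]
        · simpa using hT

/-- After greedy raising, every user lies in a tight set. Intersecting tight sets have tight union,
so the maximal ones partition `V`, and `r(V)` is a partition sum that bounds the truncation from
above. -/
theorem IsFeasible.exists_le_sum_eq (hs : IsSubmodular H) (hn : 0 < n) {r₀ : Fin n → ℝ}
    (h : IsFeasible H α Finset.univ r₀)
    (hV : fα H α Finset.univ = dilworth H α Finset.univ) :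
    ∃ r, r₀ ≤ r ∧ IsFeasible H α Finset.univ r ∧ ∑ j, r j = fα H α Finset.univ := by
  obtain ⟨r, hle, hf, ht⟩ := h.exists_le_tight Finset.univ
  refine ⟨r, hle, hf, le_antisymm (hf _ subset_rfl ⟨⟨0, hn⟩, Finset.mem_univ _⟩) ?_⟩
  let 𝒯 : Finset (Finset (Fin n)) :=
    Finset.univ.filter fun T => T.Nonempty ∧ ∑ k ∈ T, r k = fα H α T
  let ℳ := 𝒯.filter fun T => ∀ T' ∈ 𝒯, T ⊆ T' → T' = T
  have hmem : ∀ T, T ∈ 𝒯 ↔ T.Nonempty ∧ ∑ k ∈ T, r k = fα H α T := by simp [𝒯]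
  have hunion : ∀ T ∈ 𝒯, ∀ T' ∈ 𝒯, (T ∩ T').Nonempty → T ∪ T' ∈ 𝒯 := by
    intro T hT T' hT' hne
    rw [hmem] at hT hT' ⊢
    have h1 := (hf.mono (Finset.subset_univ T')).excess_union_le hs hT'.2 hne
    have hne' := hT.1.mono (Finset.subset_union_left (s₂ := T'))
    have h2 := hf (T ∪ T') (Finset.subset_univ _) hne'
    exact ⟨hne', by linarith [hT.2]⟩
  have hd : (ℳ : Set (Finset (Fin n))).PairwiseDisjoint id := by
    intro T hT T' hT' hne
    simp only [ℳ, Finset.coe_filter, Set.mem_ofPred_eq] at hT hT'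
    by_contra hnd
    have hnd : (T ∩ T').Nonempty := Finset.not_disjoint_iff_nonempty_inter.1 hnd
    have hu := hunion T hT.1 T' hT'.1 hnd
    exact hne ((hT.2 _ hu Finset.subset_union_left).symm.trans
      (hT'.2 _ hu Finset.subset_union_right))
  have hcover : fusion ℳ = Finset.univ := by
    refine Finset.eq_univ_iff_forall.2 fun j => mem_fusion.2 ?_
    obtain ⟨T, hjT, hT⟩ := ht j (Finset.mem_univ j)
    have hT : T ∈ 𝒯 := (hmem T).2 ⟨⟨j, hjT⟩, hT⟩
    obtain ⟨M, hTM, hM⟩ := 𝒯.exists_le_maximal hT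
    refine ⟨M, Finset.mem_filter.2 ⟨hM.1, fun T' hT' hMT' => ?_⟩, hTM hjT⟩
    exact Finset.Subset.antisymm (hM.2 hT' hMT') hMT'
  have he : ∅ ∉ ℳ := fun hmem' => by
    simpa using ((hmem ∅).1 (Finset.mem_filter.1 hmem').1).1
  calc fα H α Finset.univ ≤ ∑ B ∈ ℳ, fα H α B := by
        rw [hV, ← hcover]
        exact dilworth_le_sum hd he
    _ = ∑ B ∈ ℳ, ∑ j ∈ B, r j :=
        Finset.sum_congr rfl fun B hB => ((hmem B).1 (Finset.mem_filter.1 hB).1).2.symm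
    _ = ∑ j, r j := by rw [← sum_fusion hd, hcover]

end Combinatorics

/-! ### The invariant of the parametric algorithm -/

section Algorithm

variable {n : ℕ} {H : Finset (Fin n) → ℝ} {α β : ℝ}

theorem mem_of_forall_mem_iff {ι : Type*} [DecidableEq ι] {𝒬 : Finset ι} {ℳ : Finset (Finset ι)}
    (hne : ℳ.Nonempty) (hsub : ∀ 𝒳 ∈ ℳ, 𝒳 ⊆ 𝒬) (hinter : ∀ 𝒳 ∈ ℳ, ∀ 𝒴 ∈ ℳ, 𝒳 ∩ 𝒴 ∈ ℳ)
    {𝒰 : Finset ι} (h𝒰 : ∀ B, B ∈ 𝒰 ↔ B ∈ 𝒬 ∧ ∀ 𝒳 ∈ ℳ, B ∈ 𝒳) :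
    𝒰 ∈ ℳ := by
  have h1 : ℳ.inf' hne id ∈ ℳ :=
    Finset.inf'_mem {𝒳 | 𝒳 ∈ ℳ} hinter ℳ hne id fun _ h => h
  convert h1 using 1
  ext B
  have h2 : B ∈ ℳ.inf' hne id ↔ ∀ 𝒳 ∈ ℳ, B ∈ 𝒳 := by
    simpa only [id, Finset.singleton_subset_iff] using
      Finset.le_inf'_iff (a := {B}) hne id
  rw [h2, h𝒰, and_iff_right_iff_imp]
  intro hB
  obtain ⟨𝒳, hX⟩ := hne
  exact hsub 𝒳 hX (hB 𝒳 hX)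

/-- The state `s` consists of a partition of `W` into tight blocks and a rate vector that is
feasible on `W`. -/
structure IsTightPartition (H : Finset (Fin n) → ℝ) (α : ℝ) (W : Finset (Fin n))
    (s : ParState n) : Prop where
  disjoint : (s.blocks : Set (Finset (Fin n))).PairwiseDisjoint id
  empty_notMem : ∅ ∉ s.blocks
  fusion_eq : fusion s.blocks = W
  tight : ∀ B ∈ s.blocks, ∑ j ∈ B, s.rate j = fα H α B
  feasible : IsFeasible H α W s.rate

namespace IsTightPartition

variable {W : Finset (Fin n)} {s : ParState n} {i : Fin n}

theorem subset (h : IsTightPartition H α W s) {B : Finset (Fin n)} (hB : B ∈ s.blocks) : B ⊆ W :=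
  h.fusion_eq ▸ subset_fusion hB

theorem nonempty (h : IsTightPartition H α W s) {B : Finset (Fin n)} (hB : B ∈ s.blocks) :
    B.Nonempty :=
  Finset.nonempty_iff_ne_empty.2 fun he => h.empty_notMem (he ▸ hB)

theorem fα_eq_dilworth (h : IsTightPartition H α W s) {C : Finset (Fin n)} (hC : C ∈ s.blocks) :
    fα H α C = dilworth H α C :=
  (h.feasible.mono (h.subset hC)).fα_eq_dilworth (h.nonempty hC) (h.tight C hC)

theorem disjoint_insert (h : IsTightPartition H α W s) (hi : i ∉ W) :
    ((s.blocks ∪ {{i}} : Finset (Finset (Fin n))) : Set (Finset (Fin n))).PairwiseDisjoint id := by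
  rw [Finset.coe_union, Finset.coe_singleton, Set.union_singleton]
  refine h.disjoint.insert fun B hB _ => ?_
  simpa using fun hiB => hi (h.subset hB hiB)

/-- The tight blocks meeting `X` are absorbed one at a time, none of them raising the excess. -/
theorem excess_union_fusion_le (h : IsTightPartition H α W s) (hs : IsSubmodular H)
    (X : Finset (Fin n)) (𝒳 : Finset (Finset (Fin n))) (h𝒳 : 𝒳 ⊆ s.blocks)
    (hX : ∀ B ∈ 𝒳, (X ∩ B).Nonempty) :
    fα H α (X ∪ fusion 𝒳) - ∑ j ∈ X ∪ fusion 𝒳, s.rate j ≤ fα H α X - ∑ j ∈ X, s.rate j := by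
  induction 𝒳 using Finset.induction_on with
  | empty => simp [fusion]
  | insert B 𝒳 hB ih =>
    have hB' : B ∈ s.blocks := h𝒳 (Finset.mem_insert_self _ _)
    have ih := ih ((Finset.subset_insert _ _).trans h𝒳)
      fun D hD => hX D (Finset.mem_insert_of_mem hD)
    have h1 := (h.feasible.mono (h.subset hB')).excess_union_le hs (X := X ∪ fusion 𝒳)
      (h.tight B hB') ((hX B (Finset.mem_insert_self _ _)).mono
        (Finset.inter_subset_inter_right Finset.subset_union_left))
    have e : X ∪ fusion (insert B 𝒳) = X ∪ fusion 𝒳 ∪ B := by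
      rw [fusion_insert, Finset.union_assoc, Finset.union_comm B]
    rw [e]
    exact h1.trans ih

/-- The minimum of `f_α - r` over the sets that contain the new user is attained by a fusion of
blocks. -/
theorem exists_candidate_le (h : IsTightPartition H α W s) (hs : IsSubmodular H)
    {X : Finset (Fin n)} (hX : X ⊆ insert i W) (hiX : i ∈ X) :
    ∃ 𝒳 ∈ candidates (s.blocks ∪ {{i}}) i,
      fusedFun H α s.rate 𝒳 ≤ fα H α X - ∑ j ∈ X, s.rate j := by
  -- Adjoining every block that `X` meets yields a fusion of blocks with no larger excess.
  let 𝒴 := s.blocks.filter fun B => (X ∩ B).Nonempty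
  refine ⟨insert {i} 𝒴, ?_, ?_⟩
  · simp only [candidates, Finset.mem_filter, Finset.mem_powerset, Finset.mem_insert_self, and_true]
    intro B hB
    rcases Finset.mem_insert.1 hB with rfl | hB
    · simp
    · exact Finset.mem_union_left _ (Finset.mem_filter.1 hB).1
  · have e : fusion (insert {i} 𝒴) = X ∪ fusion 𝒴 := by
      rw [fusion_insert]
      refine Finset.Subset.antisymm
        (Finset.union_subset_union_left (Finset.singleton_subset_iff.2 hiX))
        (Finset.union_subset (fun j hj => ?_) Finset.subset_union_right)
      rcases Finset.mem_insert.1 (hX hj) with rfl | hjW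
      · simp
      · rw [← h.fusion_eq, mem_fusion] at hjW
        obtain ⟨B, hB, hjB⟩ := hjW
        exact Finset.mem_union_right _ (mem_fusion.2
          ⟨B, Finset.mem_filter.2 ⟨hB, j, Finset.mem_inter.2 ⟨hj, hjB⟩⟩, hjB⟩)
    rw [fusedFun, e]
    exact h.excess_union_fusion_le hs X 𝒴 (Finset.filter_subset _ _)
      fun B hB => (Finset.mem_filter.1 hB).2

theorem mem_fusion_of_mem_candidates {𝒬 𝒳 : Finset (Finset (Fin n))} (h : 𝒳 ∈ candidates 𝒬 i) :
    i ∈ fusion 𝒳 :=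
  mem_fusion.2 ⟨{i}, (Finset.mem_filter.1 h).2, by simp⟩

/-- Minimizers of a submodular function form a lattice. Intersecting submodularity is enough, since
all fusions involved contain `i`. -/
theorem minimizers_inter_mem (h : IsTightPartition H α W s) (hs : IsSubmodular H) (hi : i ∉ W)
    {𝒳 𝒴 : Finset (Finset (Fin n))} (hX : 𝒳 ∈ minimizers H α s.rate (s.blocks ∪ {{i}}) i)
    (hY : 𝒴 ∈ minimizers H α s.rate (s.blocks ∪ {{i}}) i) :
    𝒳 ∩ 𝒴 ∈ minimizers H α s.rate (s.blocks ∪ {{i}}) i := by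
  simp only [minimizers, Finset.mem_filter] at hX hY ⊢
  obtain ⟨hXc, hXm⟩ := hX
  obtain ⟨hYc, hYm⟩ := hY
  have hXc' := hXc
  have hYc' := hYc
  simp only [candidates, Finset.mem_filter, Finset.mem_powerset] at hXc hYc
  have hIc : 𝒳 ∩ 𝒴 ∈ candidates (s.blocks ∪ {{i}}) i := by
    simp only [candidates, Finset.mem_filter, Finset.mem_powerset, Finset.mem_inter]
    exact ⟨Finset.inter_subset_left.trans hXc.1, hXc.2, hYc.2⟩
  have hUc : 𝒳 ∪ 𝒴 ∈ candidates (s.blocks ∪ {{i}}) i := by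
    simp only [candidates, Finset.mem_filter, Finset.mem_powerset, Finset.mem_union]
    exact ⟨Finset.union_subset hXc.1 hYc.1, Or.inl hXc.2⟩
  have hinter := fusion_inter (h.disjoint_insert hi) hXc.1 hYc.1
  have hmem := mem_fusion_of_mem_candidates hIc
  rw [hinter] at hmem
  have h1 := hs.fα_union_add_inter (α := α) ⟨i, hmem⟩
  have h2 := Finset.sum_union_inter (s₁ := fusion 𝒳) (s₂ := fusion 𝒴) (f := s.rate)
  refine ⟨hIc, fun 𝒵 hZ => ?_⟩
  have h3 := hXm 𝒵 hZ
  have h4 := hYm _ hUc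
  simp only [fusedFun, hinter, fusion_union] at h3 h4 ⊢
  linarith

theorem minimalMinimizer_mem (h : IsTightPartition H α W s) (hs : IsSubmodular H) (hi : i ∉ W) :
    minimalMinimizer H α s.rate (s.blocks ∪ {{i}}) i ∈
      minimizers H α s.rate (s.blocks ∪ {{i}}) i := by
  have hne : (minimizers H α s.rate (s.blocks ∪ {{i}}) i).Nonempty := by
    obtain ⟨𝒳, h1, h2⟩ := Finset.exists_min_image (candidates (s.blocks ∪ {{i}}) i)
      (fusedFun H α s.rate) ⟨{{i}}, by simp [candidates]⟩
    exact ⟨𝒳, Finset.mem_filter.2 ⟨h1, h2⟩⟩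
  have hsub : ∀ 𝒳 ∈ minimizers H α s.rate (s.blocks ∪ {{i}}) i, 𝒳 ⊆ s.blocks ∪ {{i}} :=
    fun 𝒳 hX => Finset.mem_powerset.1 (Finset.mem_filter.1 (Finset.mem_filter.1 hX).1).1
  have hinter := fun 𝒳 hX 𝒴 hY => h.minimizers_inter_mem hs hi (𝒳 := 𝒳) (𝒴 := 𝒴) hX hY
  exact mem_of_forall_mem_iff hne hsub hinter fun B => Finset.mem_filter

/-- One iteration of the algorithm preserves the invariant. -/
theorem parStep (h : IsTightPartition H α W s) (hs : IsSubmodular H) (hi : i ∉ W) :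
    IsTightPartition H α (insert i W) (parStep H α i s) := by
  have hU := h.minimalMinimizer_mem hs hi
  have hd := h.disjoint_insert hi
  simp only [Omniscience.parStep]
  set 𝒬 := s.blocks ∪ {{i}} with h𝒬
  set 𝒰 := minimalMinimizer H α s.rate 𝒬 i with h𝒰
  obtain ⟨hUc, hmin⟩ := Finset.mem_filter.1 hU
  have hiU : i ∈ fusion 𝒰 := mem_fusion_of_mem_candidates hUc
  obtain ⟨hUQ, hsU⟩ := Finset.mem_filter.1 hUc
  rw [Finset.mem_powerset] at hUQ
  have hold : ∀ B ∈ 𝒬 \ 𝒰, B ∈ s.blocks := by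
    intro B hB
    rw [Finset.mem_sdiff] at hB
    rcases Finset.mem_union.1 hB.1 with h1 | h1
    · exact h1
    · exact absurd (Finset.mem_singleton.1 h1 ▸ hsU) hB.2
  have hsum : ∀ X : Finset (Fin n),
      ∑ k ∈ X, (s.rate + Pi.single i (fusedFun H α s.rate 𝒰) : Fin n → ℝ) k =
        ∑ k ∈ X, s.rate k + if i ∈ X then fusedFun H α s.rate 𝒰 else 0 := by
    intro X
    simp [Finset.sum_add_distrib, Finset.sum_pi_single']
  refine ⟨?_, ?_, ?_, ?_, ?_⟩
  · dsimp only
    rw [Finset.coe_union, Finset.coe_singleton, Set.union_singleton]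
    refine (hd.subset (by simp)).insert fun B hB _ => ?_
    rw [Finset.mem_coe, Finset.mem_sdiff] at hB
    refine Disjoint.symm ((Finset.disjoint_biUnion_right _ _ _).2 fun D hD => ?_)
    exact hd hB.1 (hUQ hD) (by rintro rfl; exact hB.2 hD)
  · dsimp only
    rw [Finset.mem_union, Finset.mem_singleton]
    rintro (h1 | h1)
    · exact h.empty_notMem (hold _ h1)
    · rw [← h1] at hiU
      simp at hiU
  · dsimp only
    have e : fusion ((𝒬 \ 𝒰) ∪ {fusion 𝒰}) = fusion 𝒬 := by
      rw [fusion_union, fusion_singleton, ← fusion_union, Finset.sdiff_union_of_subset hUQ]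
    rw [e, h𝒬, fusion_union, h.fusion_eq, fusion_singleton, Finset.union_comm,
      Finset.insert_eq]
  · intro B hB
    dsimp only at hB ⊢
    rw [hsum]
    rcases Finset.mem_union.1 hB with h1 | h1
    · have h2 := hold B h1
      rw [if_neg fun hiB => hi (h.subset h2 hiB), add_zero, h.tight B h2]
    · rw [Finset.mem_singleton.1 h1, if_pos hiU, fusedFun]
      ring
  · intro X hX hXne
    dsimp only
    rw [hsum]
    split_ifs with hiX
    -- Minimality over families of blocks bounds the raise by the excess of every set containing
    -- `i`.
    · obtain ⟨𝒳, h1, h2⟩ := h.exists_candidate_le hs hX hiX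
      linarith [hmin 𝒳 h1]
    · rw [add_zero]
      exact h.feasible X ((Finset.subset_insert_iff_of_notMem hiX).1 hX) hXne

/-- A new user whose singleton is tight is not merged with any other block. -/
theorem singleton_mem_parStep (h : IsTightPartition H α W s) (hs : IsSubmodular H) (hi : i ∉ W)
    (ht : (Omniscience.parStep H α i s).rate i = fα H α {i}) :
    {i} ∈ (Omniscience.parStep H α i s).blocks := by
  have hU := h.minimalMinimizer_mem hs hi
  simp only [Omniscience.parStep, Pi.add_apply, Pi.single_eq_same] at ht ⊢
  set 𝒬 := s.blocks ∪ {{i}} with h𝒬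
  set 𝒰 := minimalMinimizer H α s.rate 𝒬 i with h𝒰
  obtain ⟨hUc, hmin⟩ := Finset.mem_filter.1 hU
  have hc : {{i}} ∈ candidates 𝒬 i := by simp [candidates, h𝒬]
  have hm : {{i}} ∈ minimizers H α s.rate 𝒬 i := by
    -- Tightness of `{i}` says that the raise, which is the minimum, equals the excess of `{i}`.
    refine Finset.mem_filter.2 ⟨hc, fun 𝒴 hY => ?_⟩
    refine le_trans (le_of_eq ?_) (hmin 𝒴 hY)
    rw [fusedFun, fusion_singleton, Finset.sum_singleton]
    linarith
  have hsub : 𝒰 ⊆ {{i}} := fun B hB => (Finset.mem_filter.1 hB).2 _ hm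
  have heq : 𝒰 = {{i}} :=
    Finset.Subset.antisymm hsub (Finset.singleton_subset_iff.2 (Finset.mem_filter.1 hUc).2)
  rw [heq, fusion_singleton]
  simp

end IsTightPartition

/-- The first `k` users. -/
def firstUsers (n k : ℕ) : Finset (Fin n) := Finset.univ.filter fun j => j.val < k

theorem mem_firstUsers {k : ℕ} {j : Fin n} : j ∈ firstUsers n k ↔ j.val < k := by
  simp [firstUsers]

theorem firstUsers_succ {k : ℕ} (h : k < n) :
    firstUsers n (k + 1) = insert ⟨k, h⟩ (firstUsers n k) := by
  ext j
  simp only [mem_firstUsers, Finset.mem_insert, Fin.ext_iff]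
  omega

theorem isTightPartition_par (hs : IsSubmodular H) {k : ℕ} (hk : k < n) (α : ℝ) :
    IsTightPartition H α (firstUsers n (k + 1)) (par H (k + 1) α) := by
  induction k with
  | zero =>
    have e : (Finset.univ.filter fun j : Fin n => j.val = 0) = {⟨0, hk⟩} := by
      ext j
      simp [Fin.ext_iff]
    have e' : firstUsers n (0 + 1) = {⟨0, hk⟩} := by
      ext j
      simp [mem_firstUsers, Fin.ext_iff]
    rw [e']
    refine ⟨?_, ?_, ?_, ?_, ?_⟩
    · simp [par]
    · simp only [par, e, Finset.mem_singleton]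
      exact (Finset.singleton_ne_empty _).symm
    · simp [par, e, fusion]
    · simp [par, e]
    · intro X hX hXne
      rw [hXne.subset_singleton_iff.1 hX]
      simp [par]
  | succ k ih =>
    rw [firstUsers_succ hk]
    have h := (ih (by omega)).parStep hs (i := ⟨k + 1, hk⟩) (by simp [mem_firstUsers])
    simpa [par, hk] using h

/-! ### Comparison of the partitions at two values of `α` -/

/-- A block at `β` is a union of blocks at any smaller `α`. -/
theorem IsTightPartition.subset_of_inter_nonempty (hs : IsSubmodular H) {W : Finset (Fin n)}
    {s t : ParState n} (hα : IsTightPartition H α W s) (hβ : IsTightPartition H β W t)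
    (hlt : α < β) {B C : Finset (Fin n)} (hB : B ∈ s.blocks) (hC : C ∈ t.blocks)
    (hBC : (B ∩ C).Nonempty) : B ⊆ C := by
  -- Let `m` be the number of blocks at `β` that `B` meets. Uncrossing `B` with them (`h1`),
  -- feasibility at `β` on their union (`h2`) and feasibility at `α` on the pieces of `B` (`h3`) add
  -- up to `(m - 1)β ≤ (m - 1)α`. Hence `m ≤ 1`.
  let 𝒳 := t.blocks.filter fun D => (B ∩ D).Nonempty
  have hsub : 𝒳 ⊆ t.blocks := Finset.filter_subset _ _
  have hd : (𝒳 : Set (Finset (Fin n))).PairwiseDisjoint id :=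
    hβ.disjoint.subset (by simpa using hsub)
  have hcover : B ⊆ fusion 𝒳 := by
    intro j hj
    have hjW := hα.subset hB hj
    rw [← hβ.fusion_eq, mem_fusion] at hjW
    obtain ⟨D, hD, hjD⟩ := hjW
    exact mem_fusion.2 ⟨D, Finset.mem_filter.2 ⟨hD, j, Finset.mem_inter.2 ⟨hj, hjD⟩⟩, hjD⟩
  have hne : (fusion 𝒳).Nonempty := (hα.nonempty hB).mono hcover
  have hCX : C ∈ 𝒳 := Finset.mem_filter.2 ⟨hC, hBC⟩
  have h1 := hs.union_fusion_add_sum_inter B 𝒳 hd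
  rw [Finset.union_eq_right.2 hcover] at h1
  have h2 : ∑ D ∈ 𝒳, (β - H Finset.univ + H D) ≤ β - H Finset.univ + H (fusion 𝒳) := by
    calc ∑ D ∈ 𝒳, (β - H Finset.univ + H D) = ∑ D ∈ 𝒳, ∑ j ∈ D, t.rate j :=
          Finset.sum_congr rfl fun D hD => by
            rw [hβ.tight D (hsub hD), fα_of_nonempty (hβ.nonempty (hsub hD))]
      _ = ∑ j ∈ fusion 𝒳, t.rate j := (sum_fusion hd _).symm
      _ ≤ fα H β (fusion 𝒳) := hβ.feasible _
          (Finset.biUnion_subset.2 fun D hD => hβ.subset (hsub hD)) hne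
      _ = _ := fα_of_nonempty hne
  have h3 : α - H Finset.univ + H B ≤ ∑ D ∈ 𝒳, (α - H Finset.univ + H (B ∩ D)) := by
    calc α - H Finset.univ + H B = ∑ j ∈ B, s.rate j := by
          rw [hα.tight B hB, fα_of_nonempty (hα.nonempty hB)]
      _ = ∑ j ∈ B ∩ fusion 𝒳, s.rate j := by rw [Finset.inter_eq_left.2 hcover]
      _ = ∑ D ∈ 𝒳, ∑ j ∈ B ∩ D, s.rate j := by
          rw [fusion, Finset.inter_biUnion]
          exact Finset.sum_biUnion fun D hD E hE hDE =>
            (hd hD hE hDE).mono Finset.inter_subset_right Finset.inter_subset_right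
      _ ≤ _ := Finset.sum_le_sum fun D hD => by
          have hBD : (B ∩ D).Nonempty := (Finset.mem_filter.1 hD).2
          rw [← fα_of_nonempty hBD]
          exact hα.feasible _ (Finset.inter_subset_left.trans (hα.subset hB)) hBD
  simp only [Finset.sum_add_distrib, Finset.sum_const, nsmul_eq_mul] at h2 h3
  have hcard : (𝒳.card : ℝ) ≤ 1 := by
    by_contra! hc
    nlinarith
  have hcard : 𝒳.card ≤ 1 := by exact_mod_cast hcard
  intro j hj
  obtain ⟨D, hD, hjD⟩ := mem_fusion.1 (hcover hj)
  rwa [Finset.card_le_one.1 hcard C hCX D hD]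

/-- A block at `β` is tight at every smaller `α` at which it attains its Dilworth truncation. -/
theorem IsTightPartition.tight_of_le (hs : IsSubmodular H) {W : Finset (Fin n)}
    {s t : ParState n} (hα : IsTightPartition H α W s) (hβ : IsTightPartition H β W t)
    (hlt : α < β) {C : Finset (Fin n)} (hC : C ∈ t.blocks)
    (hdil : fα H α C = dilworth H α C) : ∑ j ∈ C, s.rate j = fα H α C := by
  refine le_antisymm (hα.feasible C (hβ.subset hC) (hβ.nonempty hC)) ?_
  -- By coarsening, these blocks partition `C`, so `r(C)` is a partition sum and is at least the
  -- truncation.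
  let 𝒳 := s.blocks.filter fun B => (B ∩ C).Nonempty
  have hsub : 𝒳 ⊆ s.blocks := Finset.filter_subset _ _
  have hd : (𝒳 : Set (Finset (Fin n))).PairwiseDisjoint id :=
    hα.disjoint.subset (by simpa using hsub)
  have he : ∅ ∉ 𝒳 := fun h => hα.empty_notMem (hsub h)
  have hfus : fusion 𝒳 = C := by
    refine Finset.Subset.antisymm (Finset.biUnion_subset.2 fun B hB => ?_) fun j hj => ?_
    · obtain ⟨h1, h2⟩ := Finset.mem_filter.1 hB
      exact hα.subset_of_inter_nonempty hs hβ hlt h1 hC h2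
    · have hjW := hβ.subset hC hj
      rw [← hα.fusion_eq, mem_fusion] at hjW
      obtain ⟨B, hB, hjB⟩ := hjW
      exact mem_fusion.2 ⟨B, Finset.mem_filter.2 ⟨hB, j, Finset.mem_inter.2 ⟨hjB, hj⟩⟩, hjB⟩
  calc fα H α C ≤ ∑ B ∈ 𝒳, fα H α B := by
        rw [hdil, ← hfus]
        exact dilworth_le_sum hd he
    _ = ∑ B ∈ 𝒳, ∑ j ∈ B, s.rate j :=
        Finset.sum_congr rfl fun B hB => (hα.tight B (hsub hB)).symm
    _ = ∑ j ∈ C, s.rate j := by rw [← sum_fusion hd, hfus]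

/-! ### The blocks at `ᾱ` -/

/-- This tie between the finest and the coarsest partition of `V` is what characterizes `ᾱ`. -/
theorem sum_fα_singleton_alphaBar (hn : 1 < n) :
    ∑ j : Fin n, fα H (alphaBar H) {j} = fα H (alphaBar H) Finset.univ := by
  have h1 : ((n : ℝ) - 1) ≠ 0 := by
    have : (1 : ℝ) < n := by exact_mod_cast hn
    linarith
  have h2 : ((n : ℝ) - 1) * alphaBar H = n * H Finset.univ - ∑ j : Fin n, H {j} := by
    rw [alphaBar, ← Finset.sum_div, mul_div_cancel₀ _ h1, Finset.sum_sub_distrib]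
    simp
  have hne : (Finset.univ : Finset (Fin n)).Nonempty := ⟨⟨0, by omega⟩, Finset.mem_univ _⟩
  rw [fα_of_nonempty hne]
  simp only [fα_of_nonempty (Finset.singleton_nonempty _), Finset.sum_add_distrib,
    Finset.sum_const, Finset.card_univ, Fintype.card_fin, nsmul_eq_mul]
  linarith

theorem alphaBar_nonneg (hn : 1 < n) (hm : Monotone H) : 0 ≤ alphaBar H := by
  have : (1 : ℝ) < n := by exact_mod_cast hn
  exact Finset.sum_nonneg fun j _ =>
    div_nonneg (sub_nonneg.2 (hm (Finset.subset_univ _))) (by linarith)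

/-- The singleton sum has slope `n` in `α` and `f_α(V)` has slope `1`; below the tie at `ᾱ` the
singletons are strictly cheaper. -/
theorem alphaBar_le (hn : 1 < n) (h : fα H α Finset.univ = dilworth H α Finset.univ) :
    alphaBar H ≤ α := by
  have hne : (Finset.univ : Finset (Fin n)).Nonempty := ⟨⟨0, by omega⟩, Finset.mem_univ _⟩
  have h1 := (fα_eq_dilworth_iff hne).1 h ⊥
  have h2 := sum_fα_singleton_alphaBar (H := H) hn
  have hn' : (1 : ℝ) < n := by exact_mod_cast hn
  rw [fα_of_nonempty hne] at h1 h2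
  simp only [Finpartition.parts_bot, Finset.sum_map, Function.Embedding.coeFn_mk,
    fα_of_nonempty (Finset.singleton_nonempty _), Finset.sum_add_distrib,
    Finset.sum_const, Finset.card_univ, Fintype.card_fin, nsmul_eq_mul] at h1 h2
  nlinarith

/-- Were `V` a block, the tie at `ᾱ` would make every singleton tight. The user processed last would
then have stayed alone. -/
theorem ssubset_univ_of_mem_blocks (hs : IsSubmodular H) (hn : 1 < n) {k : ℕ} (hk : k + 1 < n)
    {C : Finset (Fin n)} (hC : C ∈ (par H (k + 2) (alphaBar H)).blocks) :
    C ⊂ Finset.univ := by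
  have hinv := isTightPartition_par hs hk (alphaBar H)
  rw [Finset.ssubset_univ_iff]
  rintro rfl
  have hW : firstUsers n (k + 1 + 1) = Finset.univ :=
    Finset.eq_univ_iff_forall.2 fun j => hinv.subset hC (Finset.mem_univ j)
  have htight := hinv.tight _ hC
  have hfeas := hinv.feasible
  rw [hW] at hfeas
  rw [← sum_fα_singleton_alphaBar hn] at htight
  have heq := (Finset.sum_eq_sum_iff_of_le fun j _ => by
    simpa using hfeas {j} (Finset.subset_univ _) (Finset.singleton_nonempty _)).1 htight
  have hp : par H (k + 1 + 1) (alphaBar H) =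
      parStep H (alphaBar H) ⟨k + 1, hk⟩ (par H (k + 1) (alphaBar H)) := by
    simp [par, hk]
  have hlast := heq ⟨k + 1, hk⟩ (Finset.mem_univ _)
  rw [hp] at hlast
  have hsing := (isTightPartition_par hs (k := k) (by omega) (alphaBar H)).singleton_mem_parStep hs
    (i := ⟨k + 1, hk⟩) (by simp [mem_firstUsers]) hlast
  rw [← hp] at hsing
  have := hinv.disjoint.elim_finset hC hsing ⟨k + 1, hk⟩ (by simp) (by simp)
  have hcard := congrArg Finset.card this
  simp at hcard
  omega

/-! ### Complimentary subsets -/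

/-- A set whose critical value does not exceed that of the whole user set is complimentary. -/
theorem isComplimentary_of_le (hs : IsSubmodular H) (hm : Monotone H) (hn : 1 < n)
    {C : Finset (Fin n)} (hcard : 1 < C.card) (hCV : C ⊂ Finset.univ) {a b : ℝ}
    (ha : IsLeast {α : ℝ | 0 ≤ α ∧ fα H α C = dilworth H α C} a)
    (hb : IsLeast {α : ℝ | 0 ≤ α ∧ fα H α Finset.univ = dilworth H α Finset.univ} b)
    (hab : a ≤ b) {r : Fin n → ℝ} (hr : IsFeasible H a C r) (ht : ∑ j ∈ C, r j = fα H a C) :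
    IsComplimentary H C := by
  let r₁ : Fin n → ℝ := fun j => if j ∈ C then r j else 0
  have hsum : ∀ X : Finset (Fin n), ∑ j ∈ X, r₁ j = ∑ j ∈ X ∩ C, r j := fun X => by
    simp [r₁, Finset.sum_ite_mem]
  have hV : (Finset.univ : Finset (Fin n)).Nonempty := ⟨⟨0, by omega⟩, Finset.mem_univ _⟩
  have hfeas : IsFeasible H b Finset.univ r₁ := by
    intro X _ hX
    rw [hsum, fα_of_nonempty hX]
    rcases (X ∩ C).eq_empty_or_nonempty with he | hne
    -- For `X` disjoint from `C` the claim is `0 ≤ f_b(X)`. Testing the truncation at `V` on `{X,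
    -- Xᶜ}` gives `f_b(X) ≥ H(V) - H(Xᶜ)`.
    · have hXc : Xᶜ.Nonempty := by
        obtain ⟨j, hj⟩ : C.Nonempty := Finset.card_pos.1 (by omega)
        refine ⟨j, Finset.mem_compl.2 fun hjX => ?_⟩
        simpa [he] using Finset.mem_inter.2 ⟨hjX, hj⟩
      have hne : X ≠ Xᶜ := fun h => by
        obtain ⟨j, hj⟩ := hX
        exact Finset.mem_compl.1 (h ▸ hj) hj
      have hd : (({X, Xᶜ} : Finset (Finset (Fin n))) :
          Set (Finset (Fin n))).PairwiseDisjoint id := by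
        rw [Finset.coe_pair, Set.PairwiseDisjoint, Set.pairwise_pair_of_symm]
        exact fun _ => disjoint_compl_right
      have h1 := dilworth_le_sum (H := H) (α := b) hd (by
        simp [hX.ne_empty.symm, hXc.ne_empty.symm])
      rw [fusion_insert, fusion_singleton, Finset.union_compl, ← hb.1.2, Finset.sum_pair hne,
        fα_of_nonempty hX, fα_of_nonempty hXc, fα_of_nonempty hV] at h1
      rw [he, Finset.sum_empty]
      linarith [hm (Finset.subset_univ Xᶜ)]
    · have h1 := hr _ Finset.inter_subset_right hne
      rw [fα_of_nonempty hne] at h1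
      linarith [hm (Finset.inter_subset_left : X ∩ C ⊆ X)]
  obtain ⟨r', hle, hf, ht'⟩ := hfeas.exists_le_sum_eq hs (by omega) hb.1.2
  refine ⟨hcard, hCV, r₁, r' - r₁, fun i hi => if_neg hi, fun i => sub_nonneg.2 (hle i), ?_, ?_⟩
  · refine isOptimalRate_of_isLeast hm hcard ha (fun X hX hXne => ?_) ?_
    · rw [hsum, Finset.inter_eq_left.2 hX]
      exact hr X hX hXne
    · rw [hsum, Finset.inter_self, ht]
  · rw [add_sub_cancel]
    exact isOptimalRate_of_isLeast hm (by simpa using hn) hb hf ht'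

/-- The parametric algorithm for a normalized monotone submodular function. -/
theorem par_alphaBar_blocks (h0 : H ∅ = 0) (hm : Monotone H) (hs : IsSubmodular H) (hn : 1 < n)
    {k : ℕ} (hk : k + 1 < n) {C : Finset (Fin n)}
    (hC : C ∈ (par H (k + 2) (alphaBar H)).blocks) (hcard : 1 < C.card) :
    fα H (alphaBar H) C = dilworth H (alphaBar H) C ∧
      IsComplimentary H C ∧
      ∃ a : ℝ, IsLeast {α : ℝ | 0 ≤ α ∧ fα H α C = dilworth H α C} a ∧
        IsOptimalRate H C (par H (k + 2) a).rate ∧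
        ∑ j ∈ C, (par H (k + 2) a).rate j = minSumRate H C := by
  have hinv := isTightPartition_par hs hk
  have hCne : C.Nonempty := Finset.card_pos.1 (by omega)
  have hdil := (hinv (alphaBar H)).fα_eq_dilworth hC
  obtain ⟨a, ha⟩ := exists_isLeast hs h0 hm hCne
  obtain ⟨b, hb⟩ := exists_isLeast hs h0 hm (C := Finset.univ)
    ⟨⟨0, by omega⟩, Finset.mem_univ _⟩
  have hale : a ≤ alphaBar H := ha.2 ⟨alphaBar_nonneg hn hm, hdil⟩
  have hfeas : IsFeasible H a C (par H (k + 2) a).rate :=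
    (hinv a).feasible.mono ((hinv _).subset hC)
  have ht : ∑ j ∈ C, (par H (k + 2) a).rate j = fα H a C := by
    -- Coarsening requires strict inequality; at equality `C` is itself a block.
    rcases hale.eq_or_lt with rfl | hlt
    · exact (hinv _).tight C hC
    · exact (hinv a).tight_of_le hs (hinv _) hlt hC ha.1.2
  have hopt := isOptimalRate_of_isLeast hm hcard ha hfeas ht
  exact ⟨hdil, isComplimentary_of_le hs hm hn hcard (ssubset_univ_of_mem_blocks hs hn hk hC) ha hb
    (hale.trans (alphaBar_le hn hb.1.2)) hfeas ht, a, ha, hopt, hopt.sum_eq_minSumRate⟩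

end Algorithm

/-! ### Shannon entropy of discrete random variables -/

section Entropy

variable {Ω A B D : Type*} [MeasurableSpace Ω] {μ : Measure Ω}

/-- The probability that `g` takes the value that it takes at `ω`. -/
def atomMass (μ : Measure Ω) (g : Ω → A) (ω : Ω) : ℝ := μ.real (g ⁻¹' {g ω})

theorem atomMass_le_one [IsProbabilityMeasure μ] (g : Ω → A) (ω : Ω) : atomMass μ g ω ≤ 1 :=
  measureReal_le_one

theorem atomMass_nonneg (g : Ω → A) (ω : Ω) : 0 ≤ atomMass μ g ω := measureReal_nonneg

theorem atomMass_le_of_imp [IsFiniteMeasure μ] {g : Ω → A} {h : Ω → B} {ω : Ω}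
    (hgh : ∀ ω', g ω' = g ω → h ω' = h ω) : atomMass μ g ω ≤ atomMass μ h ω :=
  measureReal_mono hgh

theorem neg_log_atomMass_nonneg [IsProbabilityMeasure μ] (g : Ω → A) (ω : Ω) :
    0 ≤ -Real.log (atomMass μ g ω) :=
  neg_nonneg.2 (Real.log_nonpos (atomMass_nonneg g ω) (atomMass_le_one g ω))

variable [MeasurableSpace A] [Countable A] [MeasurableSingletonClass A]
  [MeasurableSpace B] [Countable B] [MeasurableSingletonClass B]

theorem lintegral_comp_eq_tsum {g : Ω → A} (hg : Measurable g) (F : A → ENNReal) :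
    ∫⁻ ω, F (g ω) ∂μ = ∑' a, F a * μ (g ⁻¹' {a}) := by
  rw [← lintegral_map (measurable_of_countable F) hg, lintegral_countable']
  simp_rw [Measure.map_apply hg (measurableSet_singleton _)]

theorem measurable_atomMass {g : Ω → A} (hg : Measurable g) : Measurable (atomMass μ g) :=
  (measurable_of_countable fun a => μ.real (g ⁻¹' {a})).comp hg

theorem ae_atomMass_pos [IsFiniteMeasure μ] {g : Ω → A} (hg : Measurable g) :
    ∀ᵐ ω ∂μ, 0 < atomMass μ g ω := by
  refine ae_of_ae_map (p := fun a => 0 < μ.real (g ⁻¹' {a})) hg.aemeasurable ?_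
  rw [ae_iff_of_countable]
  intro a ha
  rw [Measure.map_apply hg (measurableSet_singleton _)] at ha
  exact ENNReal.toReal_pos ha (measure_ne_top _ _)

theorem lintegral_neg_log_atomMass [IsFiniteMeasure μ] {g : Ω → A} (hg : Measurable g) :
    ∫⁻ ω, ENNReal.ofReal (-Real.log (atomMass μ g ω)) ∂μ =
      ∑' a, ENNReal.ofReal (Real.negMulLog (μ.real (g ⁻¹' {a}))) := by
  unfold atomMass
  rw [lintegral_comp_eq_tsum hg fun a => ENNReal.ofReal (-Real.log (μ.real (g ⁻¹' {a})))]
  refine tsum_congr fun a => ?_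
  rw [← ofReal_measureReal, ← ENNReal.ofReal_mul' measureReal_nonneg, Real.negMulLog]
  congr 1
  ring

/-- No summability is needed: in the divergent case both sides are zero by convention. -/
theorem integral_neg_log_atomMass [IsProbabilityMeasure μ] {g : Ω → A} (hg : Measurable g) :
    ∫ ω, -Real.log (atomMass μ g ω) ∂μ = ∑' a, Real.negMulLog (μ.real (g ⁻¹' {a})) := by
  rw [integral_eq_lintegral_of_nonneg_ae (ae_of_all _ (neg_log_atomMass_nonneg g))
      (measurable_atomMass hg).log.neg.aestronglyMeasurable,
    lintegral_neg_log_atomMass hg, ENNReal.tsum_toReal_eq fun _ => ENNReal.ofReal_ne_top]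
  exact tsum_congr fun a =>
    ENNReal.toReal_ofReal (Real.negMulLog_nonneg measureReal_nonneg measureReal_le_one)

theorem integrable_neg_log_atomMass [IsProbabilityMeasure μ] {g : Ω → A} (hg : Measurable g)
    (hs : Summable fun a => Real.negMulLog (μ.real (g ⁻¹' {a}))) :
    Integrable (fun ω => -Real.log (atomMass μ g ω)) μ := by
  refine ⟨(measurable_atomMass hg).log.neg.aestronglyMeasurable, ?_⟩
  rw [hasFiniteIntegral_iff_ofReal (ae_of_all _ (neg_log_atomMass_nonneg g)),
    lintegral_neg_log_atomMass hg]
  exact hs.tsum_ofReal_lt_top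

theorem neg_log_atomMass_le_ae [IsFiniteMeasure μ] {g : Ω → A} {h : Ω → D} (hg : Measurable g)
    (hgh : ∀ ω ω', g ω' = g ω → h ω' = h ω) :
    ∀ᵐ ω ∂μ, -Real.log (atomMass μ h ω) ≤ -Real.log (atomMass μ g ω) := by
  -- Null atoms must be discarded, since `Real.log 0 = 0` would break the inequality there.
  filter_upwards [ae_atomMass_pos hg] with ω hω
  exact neg_le_neg (Real.log_le_log hω (atomMass_le_of_imp (hgh ω)))

/-- The change of measure under which `g` and `h` become conditionally independent given a
common function `φ ∘ g = ψ ∘ h` has total mass at most one. -/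
theorem lintegral_density_le_one [IsProbabilityMeasure μ] {g : Ω → A} {h : Ω → B}
    (hg : Measurable g) (hh : Measurable h) (φ : A → D) (ψ : B → D)
    (hφψ : ∀ ω, φ (g ω) = ψ (h ω)) :
    ∫⁻ ω, μ (g ⁻¹' {g ω}) * μ (h ⁻¹' {h ω}) /
      (μ ((fun ω => (g ω, h ω)) ⁻¹' {(g ω, h ω)}) * μ ((φ ∘ g) ⁻¹' {φ (g ω)})) ∂μ ≤ 1 := by
  classical
  -- Summing the law of `h` over a fibre of `ψ` gives the law of the common function.
  have hsum : ∀ d : D, ∑' b, (if ψ b = d then 1 else 0) * μ (h ⁻¹' {b}) = μ ((φ ∘ g) ⁻¹' {d}) := by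
    intro d
    have hms : MeasurableSet ((φ ∘ g) ⁻¹' {d}) := by
      rw [Set.preimage_comp]
      exact hg (Set.to_countable _).measurableSet
    rw [← lintegral_comp_eq_tsum hh fun b => if ψ b = d then 1 else 0, ← lintegral_indicator_one hms]
    refine lintegral_congr fun ω => ?_
    simp [Set.indicator_apply, ← hφψ]
  rw [lintegral_comp_eq_tsum (hg.prodMk hh) fun p => μ (g ⁻¹' {p.1}) * μ (h ⁻¹' {p.2}) /
      (μ ((fun ω => (g ω, h ω)) ⁻¹' {p}) * μ ((φ ∘ g) ⁻¹' {φ p.1}))]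
  calc _ ≤ ∑' p : A × B, μ (g ⁻¹' {p.1}) / μ ((φ ∘ g) ⁻¹' {φ p.1}) *
        ((if ψ p.2 = φ p.1 then 1 else 0) * μ (h ⁻¹' {p.2})) := by
        refine ENNReal.tsum_le_tsum fun ⟨a, b⟩ => ?_
        set q := μ ((fun ω => (g ω, h ω)) ⁻¹' {(a, b)}) with hq
        rcases eq_or_ne q 0 with h0 | h0
        · simp [h0]
        · have hab : ψ b = φ a := by
            obtain ⟨ω, hω⟩ := nonempty_of_measure_ne_zero h0
            simp only [Set.mem_preimage, Set.mem_singleton_iff, Prod.mk.injEq] at hω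
            rw [← hω.1, ← hω.2, hφψ]
          have hqt : q ≠ ⊤ := measure_ne_top _ _
          rw [if_pos hab, one_mul, div_eq_mul_inv, div_eq_mul_inv,
            ENNReal.mul_inv (Or.inl h0) (Or.inl hqt)]
          refine le_of_eq ?_
          calc _ = μ (g ⁻¹' {a}) * (μ ((φ ∘ g) ⁻¹' {φ a}))⁻¹ * μ (h ⁻¹' {b}) * (q⁻¹ * q) := by ring
            _ = _ := by rw [ENNReal.inv_mul_cancel h0 hqt, mul_one]
    _ = ∑' a, μ (g ⁻¹' {a}) / μ ((φ ∘ g) ⁻¹' {φ a}) * μ ((φ ∘ g) ⁻¹' {φ a}) := by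
        rw [ENNReal.tsum_prod']
        simp_rw [ENNReal.tsum_mul_left, hsum]
    _ ≤ ∑' a, 1 * μ (g ⁻¹' {a}) := by
        refine ENNReal.tsum_le_tsum fun a => ?_
        rw [one_mul]
        -- Only an inequality: the divisor may vanish.
        exact ENNReal.mul_le_of_le_div le_rfl
    _ = 1 := by
        rw [← lintegral_comp_eq_tsum hg fun _ => 1]
        simp

/-- Conditional mutual information is nonnegative. -/
theorem integral_neg_log_atomMass_submodular [IsProbabilityMeasure μ] {g : Ω → A} {h : Ω → B}
    (hg : Measurable g) (hh : Measurable h) (φ : A → D) (ψ : B → D)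
    (hφψ : ∀ ω, φ (g ω) = ψ (h ω))
    (ig : Integrable (fun ω => -Real.log (atomMass μ g ω)) μ)
    (ih : Integrable (fun ω => -Real.log (atomMass μ h ω)) μ)
    (igh : Integrable (fun ω => -Real.log (atomMass μ (fun ω => (g ω, h ω)) ω)) μ)
    (ik : Integrable (fun ω => -Real.log (atomMass μ (φ ∘ g) ω)) μ) :
    ∫ ω, -Real.log (atomMass μ (fun ω => (g ω, h ω)) ω) ∂μ +
        ∫ ω, -Real.log (atomMass μ (φ ∘ g) ω) ∂μ ≤
      ∫ ω, -Real.log (atomMass μ g ω) ∂μ + ∫ ω, -Real.log (atomMass μ h ω) ∂μ := by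
  have hJ := lintegral_density_le_one (μ := μ) hg hh φ ψ hφψ
  set J : Ω → ENNReal := fun ω => μ (g ⁻¹' {g ω}) * μ (h ⁻¹' {h ω}) /
    (μ ((fun ω => (g ω, h ω)) ⁻¹' {(g ω, h ω)}) * μ ((φ ∘ g) ⁻¹' {φ (g ω)})) with hJdef
  have hJm : Measurable J :=
    (measurable_of_countable fun p : A × B => μ (g ⁻¹' {p.1}) * μ (h ⁻¹' {p.2}) /
      (μ ((fun ω => (g ω, h ω)) ⁻¹' {p}) * μ ((φ ∘ g) ⁻¹' {φ p.1}))).comp (hg.prodMk hh)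
  have hJt : ∫⁻ ω, J ω ∂μ ≠ ⊤ := (hJ.trans_lt ENNReal.one_lt_top).ne
  have hJi : Integrable (fun ω => (J ω).toReal) μ :=
    integrable_toReal_of_lintegral_ne_top hJm.aemeasurable hJt
  have hJ1 : ∫ ω, (J ω).toReal ∂μ ≤ 1 := by
    rw [integral_toReal hJm.aemeasurable (ae_lt_top hJm hJt)]
    exact ENNReal.toReal_le_of_le_ofReal zero_le_one (by simpa using hJ)
  -- `D` carries no measurable structure, so positivity is inherited from the smaller atoms of `g`.
  have hk : ∀ᵐ ω ∂μ, 0 < atomMass μ (φ ∘ g) ω := by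
    filter_upwards [ae_atomMass_pos hg] with ω hω
    exact hω.trans_le (atomMass_le_of_imp fun ω' h' => congrArg φ h')
  -- Gibbs' inequality: `log J ≤ J - 1` almost everywhere, where `J` has integral at most one.
  have hle : ∫ ω, (-Real.log (atomMass μ (fun ω => (g ω, h ω)) ω) +
      -Real.log (atomMass μ (φ ∘ g) ω)) ∂μ ≤ ∫ ω, (-Real.log (atomMass μ g ω) +
        -Real.log (atomMass μ h ω) + ((J ω).toReal - 1)) ∂μ := by
    refine integral_mono_ae (igh.add ik)
      ((ig.add ih).add (hJi.sub (integrable_const 1))) ?_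
    filter_upwards [ae_atomMass_pos hg, ae_atomMass_pos hh, ae_atomMass_pos (hg.prodMk hh), hk]
      with ω h1 h2 h3 h4
    have hJω : (J ω).toReal = atomMass μ g ω * atomMass μ h ω /
        (atomMass μ (fun ω => (g ω, h ω)) ω * atomMass μ (φ ∘ g) ω) := by
      simp [hJdef, atomMass, Measure.real, ENNReal.toReal_div, ENNReal.toReal_mul]
    have hlog := Real.log_le_sub_one_of_pos (div_pos (mul_pos h1 h2) (mul_pos h3 h4))
    rw [Real.log_div (mul_pos h1 h2).ne' (mul_pos h3 h4).ne', Real.log_mul h1.ne' h2.ne',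
      Real.log_mul h3.ne' h4.ne'] at hlog
    rw [hJω]
    linarith
  have hJ1i : Integrable (fun ω => (J ω).toReal - 1) μ := hJi.sub (integrable_const 1)
  rw [integral_add igh ik] at hle
  rw [integral_add (f := fun ω => -Real.log (atomMass μ g ω) + -Real.log (atomMass μ h ω))
    (ig.add ih) hJ1i, integral_add ig ih,
    integral_sub hJi (integrable_const 1)] at hle
  simp only [integral_const, probReal_univ, smul_eq_mul, mul_one] at hle
  linarith

end Entropy

/-! ### Joint entropy as a normalized monotone submodular function -/

section JointEntropy

variable {n : ℕ} {Ω : Type*} [MeasurableSpace Ω] {μ : Measure Ω} [IsProbabilityMeasure μ]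
  {S : Fin n → Type*} {Z : ∀ i, Ω → S i}

/-- The subfamily `(Z i : i ∈ X)` as one random variable. -/
def subfamily (Z : ∀ i, Ω → S i) (X : Finset (Fin n)) (ω : Ω) : ∀ i : X, S i := fun i => Z i ω

theorem subfamily_eq_iff {Ω : Type*} {Z : ∀ i, Ω → S i} {X : Finset (Fin n)} {ω ω' : Ω} :
    subfamily Z X ω' = subfamily Z X ω ↔ ∀ i ∈ X, Z i ω' = Z i ω := by
  simp [subfamily, funext_iff]

theorem jointEntropy_empty : jointEntropy μ Z ∅ = 0 := by
  simp [jointEntropy]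

variable [∀ i, MeasurableSpace (S i)]

theorem measurable_subfamily (hZ : ∀ i, Measurable (Z i)) (X : Finset (Fin n)) :
    Measurable (subfamily Z X) :=
  measurable_pi_lambda _ fun i => hZ i

variable [∀ i, Countable (S i)] [∀ i, MeasurableSingletonClass (S i)]

/-- Entropies over different alphabets become integrals over the same `Ω`, where they can be
compared pointwise. -/
theorem jointEntropy_eq_integral (hZ : ∀ i, Measurable (Z i)) (X : Finset (Fin n)) :
    jointEntropy μ Z X = (∫ ω, -Real.log (atomMass μ (subfamily Z X) ω) ∂μ) / Real.log 2 := by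
  rw [integral_neg_log_atomMass (measurable_subfamily hZ X), jointEntropy]
  congr 1
  refine tsum_congr fun s => ?_
  congr 2
  ext ω
  simp [subfamily, funext_iff]

/-- The information content of the full family dominates that of every subfamily almost everywhere.
-/
theorem integrable_subfamily (hZ : ∀ i, Measurable (Z i))
    (hfin : Summable fun s : (∀ i, S i) => Real.negMulLog (μ.real {ω | ∀ i, Z i ω = s i}))
    (X : Finset (Fin n)) :
    Integrable (fun ω => -Real.log (atomMass μ (subfamily Z X) ω)) μ := by
  have hm : Measurable fun ω i => Z i ω := measurable_pi_lambda _ hZ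
  have hi : Integrable (fun ω => -Real.log (atomMass μ (fun ω i => Z i ω) ω)) μ := by
    refine integrable_neg_log_atomMass hm (hfin.congr fun s => ?_)
    congr 2
    ext ω
    simp [funext_iff]
  refine hi.mono'
    (measurable_atomMass (measurable_subfamily hZ X)).log.neg.aestronglyMeasurable ?_
  filter_upwards [neg_log_atomMass_le_ae (h := subfamily Z X) hm fun ω ω' he =>
    subfamily_eq_iff.2 fun i _ => congrFun he i] with ω hω
  rwa [Real.norm_of_nonneg (neg_log_atomMass_nonneg _ _)]

theorem jointEntropy_mono (hZ : ∀ i, Measurable (Z i))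
    (hfin : Summable fun s : (∀ i, S i) => Real.negMulLog (μ.real {ω | ∀ i, Z i ω = s i})) :
    Monotone (jointEntropy μ Z) := by
  intro X Y hXY
  rw [jointEntropy_eq_integral hZ, jointEntropy_eq_integral hZ]
  refine div_le_div_of_nonneg_right ?_ (Real.log_nonneg one_le_two)
  exact integral_mono_ae (integrable_subfamily hZ hfin X) (integrable_subfamily hZ hfin Y)
    (neg_log_atomMass_le_ae (measurable_subfamily hZ Y) fun ω ω' he =>
      subfamily_eq_iff.2 fun i hi => subfamily_eq_iff.1 he i (hXY hi))

theorem jointEntropy_submodular (hZ : ∀ i, Measurable (Z i))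
    (hfin : Summable fun s : (∀ i, S i) => Real.negMulLog (μ.real {ω | ∀ i, Z i ω = s i})) :
    IsSubmodular (jointEntropy μ Z) := by
  intro X Y
  -- The pair and the subfamily over `X ∪ Y` have different alphabets but the same level sets.
  have hpair : ∀ ω, atomMass μ (fun ω => (subfamily Z X ω, subfamily Z Y ω)) ω =
      atomMass μ (subfamily Z (X ∪ Y)) ω := by
    intro ω
    apply le_antisymm <;> refine atomMass_le_of_imp fun ω' he => ?_
    · rw [Prod.mk.injEq, subfamily_eq_iff, subfamily_eq_iff] at he
      exact subfamily_eq_iff.2 fun i hi => (Finset.mem_union.1 hi).elim (he.1 i) (he.2 i)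
    · rw [subfamily_eq_iff] at he
      rw [Prod.mk.injEq, subfamily_eq_iff, subfamily_eq_iff]
      exact ⟨fun i hi => he i (Finset.mem_union_left _ hi),
        fun i hi => he i (Finset.mem_union_right _ hi)⟩
  -- Both restrict to the coordinates in `X ∩ Y`, the common function to condition on.
  let φ : (∀ i : X, S i) → ∀ i : (X ∩ Y : Finset (Fin n)), S i :=
    fun s i => s ⟨i, Finset.inter_subset_left i.2⟩
  let ψ : (∀ i : Y, S i) → ∀ i : (X ∩ Y : Finset (Fin n)), S i :=
    fun s i => s ⟨i, Finset.inter_subset_right i.2⟩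
  have hφ : φ ∘ subfamily Z X = subfamily Z (X ∩ Y) := rfl
  have h1 := integral_neg_log_atomMass_submodular (μ := μ) (measurable_subfamily hZ X)
    (measurable_subfamily hZ Y) φ ψ (fun ω => rfl) (integrable_subfamily hZ hfin X)
    (integrable_subfamily hZ hfin Y)
    (by simpa only [hpair] using integrable_subfamily hZ hfin (X ∪ Y))
    (integrable_subfamily hZ hfin (X ∩ Y))
  simp only [hpair, hφ] at h1
  simp only [jointEntropy_eq_integral hZ, ← add_div]
  exact div_le_div_of_nonneg_right h1 (Real.log_nonneg one_le_two)

end JointEntropy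

end Omniscience

end

theorem theorem2 {n : ℕ} (hn : 1 < n)
    {Ω : Type*} [MeasurableSpace Ω] (μ : MeasureTheory.Measure Ω)
    [MeasureTheory.IsProbabilityMeasure μ]
    {S : Fin n → Type*} [∀ i, Countable (S i)] [∀ i, MeasurableSpace (S i)]
    [∀ i, MeasurableSingletonClass (S i)]
    (Z : ∀ i, Ω → S i) (hZ : ∀ i, Measurable (Z i))
    -- the joint entropy of the whole source is finite
    (hfin : Summable fun s : (∀ i, S i) => Real.negMulLog (μ.real {ω | ∀ i, Z i ω = s i}))
    (H : Finset (Fin n) → ℝ) (hH : H = Omniscience.jointEntropy μ Z)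
    (i : ℕ) (hi : 2 ≤ i) (hin : i ≤ n)
    (C : Finset (Fin n)) (hC : C ∈ (Omniscience.par H i (Omniscience.alphaBar H)).blocks)
    (hcard : 1 < C.card) :
    Omniscience.fα H (Omniscience.alphaBar H) C
        = Omniscience.dilworth H (Omniscience.alphaBar H) C ∧
      Omniscience.IsComplimentary H C ∧
      ∃ αC : ℝ,
        IsLeast {α : ℝ | 0 ≤ α ∧ Omniscience.fα H α C = Omniscience.dilworth H α C} αC ∧
        Omniscience.IsOptimalRate H C (Omniscience.par H i αC).rate ∧
        ∑ j ∈ C, (Omniscience.par H i αC).rate j = Omniscience.minSumRate H C := by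
  subst hH
  obtain ⟨k, rfl⟩ := Nat.exists_eq_add_of_le' hi
  exact Omniscience.par_alphaBar_blocks Omniscience.jointEntropy_empty
    (Omniscience.jointEntropy_mono hZ hfin) (Omniscience.jointEntropy_submodular hZ hfin) hn
    (by omega) hC hcard
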